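/- Let $m\ge n\ge 1$, $A\in\mathbb{R}^{m\times n}$ and $b\in\mathbb{R}^m$. A vector $x\in\mathbb{R}^n$ is a \emph{total least squares} (TLS) solution of $Ax\approx b$ if $(A+E)x=b+f$ for some $[E,\,f]$ that minimizes $\|[E,\,f]\|_F$ subject to $b+f\in\mathscr{R}(A+E)$, where $\mathscr{R}$ denotes the range. Let $\widetilde\sigma_n$ be the smallest ($n$-th) singular value of $A$, and let $\sigma_{n+1}$ be the $(n+1)$-st singular value of $[A,\,b]$, with $\sigma_{n+1}=0$ if $m=n$. Assume the genericity condition $\widetilde\sigma_n>\sigma_{n+1}$. Then $Ax\approx b$ has exactly one TLS solution $x$. Suppose $x\neq 0$ and put $r=b-Ax$. Then there are constants $C$ and $\eta>0$ (depending on $A$ and $b$) such that, for all $\delta A\in\mathbb{R}^{m\times n}$ and $\delta b\in\mathbb{R}^m$ with $\|[\delta A,\,\delta b]\|_F\le\eta$, the perturbed problem with data $[A+\delta A,\ b+\delta b]$ has exactly one TLS solution $x+\delta x$, and $$\frac{\|\delta x\|_2}{\|x\|_2}\le\left[\left\|(A^{\mathrm T}A-\sigma_{n+1}^2I_n)^{-1}A^{\mathrm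 T}\right\|_2\frac{\sqrt{1+\|x\|_2^2}}{\|x\|_2}+\left\|(A^{\mathrm T}A-\sigma_{n+1}^2I_n)^{-1}\right\|_2\frac{\|r\|_2}{\|x\|_2}\right]\left\|[\delta A,\,\delta b]\right\|_2+C\,\|[\delta A,\,\delta b]\|_F^2 .$$ Here $\|\cdot\|_2$ is the Euclidean norm of vectors and the spectral norm of matrices, and $\|\cdot\|_F$ is the Frobenius norm. -/

import Mathlib

noncomputable section

namespace TLS

/-- The augmented matrix `[A, b]`, of size `m × (n + 1)`. -/
def augment {m n : ℕ} (A : Matrix (Fin m) (Fin n) ℝ) (b : EuclideanSpace ℝ (Fin m)) :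
    Matrix (Fin m) (Fin n ⊕ Unit) ℝ :=
  Matrix.fromCols A (Matrix.replicateCol Unit b.ofLp)

/-- The spectral norm `‖M‖₂`: the operator norm of `M` between Euclidean spaces. -/
def specNorm {ι κ : Type*} [Fintype ι] [Fintype κ] [DecidableEq κ] (M : Matrix ι κ ℝ) : ℝ :=
  ‖(Matrix.toEuclideanLin M).toContinuousLinearMap‖

/-- The Frobenius norm `‖M‖_F`. -/
def frobNorm {ι κ : Type*} [Fintype ι] [Fintype κ] (M : Matrix ι κ ℝ) : ℝ :=
  Real.sqrt (∑ i, ∑ j, M i j ^ 2)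

/-- The `k`-th largest singular value of `M`, counted from `k = 1` with multiplicity; it is `0`
for `k` larger than the rank of `M`. (Mathlib counts singular values from `0`.) -/
def singularValue {ι κ : Type*} [Fintype ι] [Fintype κ] [DecidableEq κ] (M : Matrix ι κ ℝ)
    (k : ℕ) : ℝ :=
  (Matrix.toEuclideanLin M).singularValues (k - 1)

/-- `x` is a total least squares solution of `A x ≈ b`: there is a correction `[E, f]` of minimal
Frobenius norm among those with `b + f ∈ range (A + E)`, such that `(A + E) x = b + f`. -/
def IsTLSSolution {m n : ℕ} (A : Matrix (Fin m) (Fin n) ℝ) (b : EuclideanSpace ℝ (Fin m))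
    (x : EuclideanSpace ℝ (Fin n)) : Prop :=
  ∃ (E : Matrix (Fin m) (Fin n) ℝ) (f : EuclideanSpace ℝ (Fin m)),
    Matrix.toEuclideanLin (A + E) x = b + f ∧
    ∀ (E' : Matrix (Fin m) (Fin n) ℝ) (f' : EuclideanSpace ℝ (Fin m)),
      b + f' ∈ LinearMap.range (Matrix.toEuclideanLin (A + E')) →
        frobNorm (augment E f) ≤ frobNorm (augment E' f')

/-- The matrix `(Aᵀ A - σ² I)⁻¹`, where `σ` is the `(n + 1)`-st singular value of `[A, b]`
(which is `0` if `m = n`). -/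
def shiftedGramInv {m n : ℕ} (A : Matrix (Fin m) (Fin n) ℝ) (b : EuclideanSpace ℝ (Fin m)) :
    Matrix (Fin n) (Fin n) ℝ :=
  (A.transpose * A -
    (singularValue (augment A b) (n + 1) ^ 2) • (1 : Matrix (Fin n) (Fin n) ℝ))⁻¹

end TLS

end

/-!
Write `C = [A, b]`, `σ` for its bottom singular value and `r = b - A x`.

A correction `[E, f]` with `(A + E) x = b + f` sends `(x, -1)` to `r`, so its Frobenius norm is at
least `‖r‖ / √(1 + ‖x‖²)`, and the rank-one choice attains this (`norm_residual_sq_le`,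
`exists_correction`). Hence a total least squares solution is a minimizer of the Rayleigh quotient
of `CᵀC` over the vectors `(x, -1)`. Under the genericity condition no bottom eigenvector of `CᵀC`
has last coordinate `0`, so `(x, -1)` can be taken to be an eigenvector for `σ²`
(`exists_isBottomPair`), and it is the only one because `AᵀA - σ²` is positive definite
(`IsBottomPair.unique`, `isTLSSolution_iff`). The bottom singular values of `A` and of `C` are minima
of `‖M v‖ / ‖v‖`, hence 1-Lipschitz in the matrix, and the genericity condition is stable under small
perturbations.

For the perturbation bound, let `[D, d]` be the perturbation, `w = d - D x`, and let `h` and `κ` be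
the changes of `x` and of `σ²`. The eigenvector equations read `Aᵀ r = -σ² x` and
`‖r‖² = σ² (1 + ‖x‖²)`. Subtracting the normal equations of the two problems gives
`(AᵀA - σ²) h = Aᵀ w + Dᵀ r + κ x + O(ε²)` (`IsBottomPair.normal_eq_sub`), and testing the change of
`CᵀC` between the old and the new eigenvectors gives `κ = 2 ⟪r, w⟫ / (1 + ‖x‖²) + O(ε²)`
(`IsBottomPair.sub_mul_eq`, `IsBottomPair.abs_sub_firstOrder_le`). The two formulas for `r` turn
`Aᵀ w + 2 ⟪r, w⟫ / (1 + ‖x‖²) x` into `Aᵀ w'`, where `w'` is the Householder reflection of `w` along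
`r` (`IsBottomPair.exists_reflection`). As `‖w'‖ = ‖w‖ ≤ √(1 + ‖x‖²) ‖[D, d]‖₂`, the eigenvalue term
costs nothing, and the two summands of the bound come from `(AᵀA - σ²)⁻¹ Aᵀ w'` and
`(AᵀA - σ²)⁻¹ Dᵀ r`.
-/

namespace TLS

open Matrix RealInnerProductSpace

/-! ### The bottom singular value -/

section SingularValues

variable {E F : Type*} [NormedAddCommGroup E] [InnerProductSpace ℝ E] [FiniteDimensional ℝ E]
  [NormedAddCommGroup F] [InnerProductSpace ℝ F] [FiniteDimensional ℝ F]

theorem singularValues_mul_norm_le (T : E →ₗ[ℝ] F) {k : ℕ} (hk : Module.finrank ℝ E = k + 1)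
    (v : E) : T.singularValues k * ‖v‖ ≤ ‖T v‖ := by
  set hT := T.isSymmetric_adjoint_comp_self
  set e := hT.eigenvectorBasis hk
  have hsum : ‖T v‖ ^ 2 = ∑ i, hT.eigenvalues hk i * ⟪e i, v⟫ ^ 2 := by
    have h1 : ‖T v‖ ^ 2 = ⟪v, (LinearMap.adjoint T ∘ₗ T) v⟫ := by
      rw [LinearMap.comp_apply, LinearMap.adjoint_inner_right, real_inner_self_eq_norm_sq]
    rw [h1, ← e.sum_inner_mul_inner]
    refine Finset.sum_congr rfl fun i _ => ?_
    rw [← hT (e i) v, hT.apply_eigenvectorBasis, inner_smul_left, real_inner_comm v (e i)]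
    simp
    ring
  have hle : (T.singularValues k * ‖v‖) ^ 2 ≤ ‖T v‖ ^ 2 := by
    rw [mul_pow, T.sq_singularValues_of_lt hk (Nat.lt_succ_self k), hsum,
      ← e.sum_sq_norm_inner_right v, Finset.mul_sum]
    refine Finset.sum_le_sum fun i _ => ?_
    rw [Real.norm_eq_abs, sq_abs]
    refine mul_le_mul_of_nonneg_right (hT.eigenvalues_antitone hk ?_) (sq_nonneg _)
    exact Fin.le_def.2 (Nat.lt_succ_iff.1 i.2)
  exact le_of_sq_le_sq hle (norm_nonneg _)

theorem exists_norm_eq_singularValues_mul (T : E →ₗ[ℝ] F) {k : ℕ}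
    (hk : Module.finrank ℝ E = k + 1) : ∃ v ≠ 0, ‖T v‖ = T.singularValues k * ‖v‖ := by
  obtain ⟨v, hv⟩ := (T.hasEigenvalue_adjoint_comp_self_sq_singularValues
    (n := k) (by omega)).exists_hasEigenvector
  refine ⟨v, hv.2, ?_⟩
  have h1 : ‖T v‖ ^ 2 = (T.singularValues k * ‖v‖) ^ 2 := by
    rw [← real_inner_self_eq_norm_sq, ← LinearMap.adjoint_inner_right, ← LinearMap.comp_apply,
      hv.apply_eq_smul, inner_smul_right, real_inner_self_eq_norm_sq, mul_pow]
    simp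
  exact (sq_eq_sq₀ (norm_nonneg _)
    (mul_nonneg (T.singularValues_nonneg k) (norm_nonneg _))).1 h1

end SingularValues

/-! ### Augmented matrices and their norms -/

section Augment

variable {m n : ℕ}

/-- The vector `(z, t)` of `ℝⁿ⁺¹`, on which `[A, b]` acts as `A z + t b`. -/
def pair (z : EuclideanSpace ℝ (Fin n)) (t : ℝ) : EuclideanSpace ℝ (Fin n ⊕ Unit) :=
  WithLp.toLp 2 (Sum.elim z.ofLp fun _ => t)

theorem exists_pair_eq (v : EuclideanSpace ℝ (Fin n ⊕ Unit)) : ∃ z t, pair z t = v := by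
  refine ⟨WithLp.toLp 2 fun i => v (Sum.inl i), v (Sum.inr ()), ?_⟩
  ext i
  rcases i with i | i <;> simp [pair]

theorem norm_pair_sq (z : EuclideanSpace ℝ (Fin n)) (t : ℝ) :
    ‖pair z t‖ ^ 2 = ‖z‖ ^ 2 + t ^ 2 := by
  simp [EuclideanSpace.norm_sq_eq, pair]

theorem norm_pair_zero (z : EuclideanSpace ℝ (Fin n)) : ‖pair z 0‖ = ‖z‖ := by
  rw [← sq_eq_sq₀ (norm_nonneg _) (norm_nonneg _), norm_pair_sq]
  ring

theorem norm_pair_neg_one (z : EuclideanSpace ℝ (Fin n)) :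
    ‖pair z (-1)‖ = √(1 + ‖z‖ ^ 2) := by
  rw [← Real.sqrt_sq (norm_nonneg (pair z (-1))), norm_pair_sq]
  ring_nf

theorem toEuclideanLin_augment (A : Matrix (Fin m) (Fin n) ℝ) (b : EuclideanSpace ℝ (Fin m))
    (z : EuclideanSpace ℝ (Fin n)) (t : ℝ) :
    toEuclideanLin (augment A b) (pair z t) = toEuclideanLin A z + t • b := by
  ext i
  simp [augment, pair, Matrix.toLpLin_apply, Matrix.mulVec,
    dotProduct, mul_comm]

theorem frobNorm_augment_sq (A : Matrix (Fin m) (Fin n) ℝ) (b : EuclideanSpace ℝ (Fin m)) :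
    frobNorm (augment A b) ^ 2 = (∑ i, ∑ j, A i j ^ 2) + ‖b‖ ^ 2 := by
  rw [frobNorm, Real.sq_sqrt (by positivity)]
  simp [augment, EuclideanSpace.norm_sq_eq, Finset.sum_add_distrib]

variable {ι κ : Type*} [Fintype ι] [Fintype κ] [DecidableEq κ]

theorem specNorm_nonneg (M : Matrix ι κ ℝ) : 0 ≤ specNorm M := norm_nonneg _

omit [DecidableEq κ] in
theorem frobNorm_nonneg (M : Matrix ι κ ℝ) : 0 ≤ frobNorm M := Real.sqrt_nonneg _

theorem norm_toEuclideanLin_le (M : Matrix ι κ ℝ) (v : EuclideanSpace ℝ κ) :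
    ‖toEuclideanLin M v‖ ≤ specNorm M * ‖v‖ :=
  (toEuclideanLin M).toContinuousLinearMap.le_opNorm v

theorem specNorm_le_frobNorm (M : Matrix ι κ ℝ) : specNorm M ≤ frobNorm M := by
  refine ContinuousLinearMap.opNorm_le_bound _ (Real.sqrt_nonneg _) fun v => ?_
  refine le_of_sq_le_sq ?_ (mul_nonneg (Real.sqrt_nonneg _) (norm_nonneg _))
  rw [mul_pow, frobNorm, Real.sq_sqrt (by positivity), EuclideanSpace.norm_sq_eq,
    EuclideanSpace.norm_sq_eq, Finset.sum_mul]
  refine Finset.sum_le_sum fun i _ => ?_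
  simpa [Matrix.toLpLin_apply, Matrix.mulVec, dotProduct] using
    Finset.sum_mul_sq_le_sq_mul_sq Finset.univ (M i) v

end Augment

/-! ### The bottom eigenpair of the augmented operator -/

section Level

variable {E F : Type*} [NormedAddCommGroup E] [InnerProductSpace ℝ E]
  [NormedAddCommGroup F] [InnerProductSpace ℝ F]

/-- `μ` is the minimum of the Rayleigh quotient `‖A z + t b‖² / (‖z‖² + t²)` of the augmented
operator `[A, b]`, and it is attained at `(x, -1)`. -/
structure IsBottomPair (A : E →L[ℝ] F) (b : F) (μ : ℝ) (x : E) : Prop where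
  le : ∀ (z : E) (t : ℝ), μ * (‖z‖ ^ 2 + t ^ 2) ≤ ‖A z + t • b‖ ^ 2
  eq : ‖b - A x‖ ^ 2 = μ * (1 + ‖x‖ ^ 2)

theorem eq_zero_of_forall_nonneg {β γ : ℝ} (h : ∀ s : ℝ, 0 ≤ s * β + s ^ 2 * γ) : β = 0 := by
  by_contra hβ
  have hc : 0 < |γ| + 1 := by positivity
  -- at `s = -β / (|γ| + 1)` the linear term wins
  have := h (-β / (|γ| + 1))
  have h2 : -β / (|γ| + 1) * β + (-β / (|γ| + 1)) ^ 2 * γ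
      = β ^ 2 / (|γ| + 1) ^ 2 * (γ - |γ| - 1) := by
    field_simp
    ring
  rw [h2] at this
  have h3 : 0 < β ^ 2 / (|γ| + 1) ^ 2 := by positivity
  nlinarith [le_abs_self γ]

variable {A : E →L[ℝ] F} {b : F} {μ : ℝ} {x : E}

/-- The eigenvector equation `[A, b]ᵀ [A, b] (x, -1) = μ (x, -1)`, tested against `(z, t)`. -/
theorem IsBottomPair.inner_residual (h : IsBottomPair A b μ x) (z : E) (t : ℝ) :
    ⟪b - A x, A z + t • b⟫ = μ * (t - ⟪x, z⟫) := by
  have key : ∀ s : ℝ, 0 ≤ s * (-2 * (⟪b - A x, A z + t • b⟫ - μ * (t - ⟪x, z⟫)))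
      + s ^ 2 * (‖A z + t • b‖ ^ 2 - μ * (‖z‖ ^ 2 + t ^ 2)) := by
    intro s
    have h1 := h.le (x + s • z) (-1 + s * t)
    have h2 : A (x + s • z) + (-1 + s * t) • b = s • (A z + t • b) - (b - A x) := by
      rw [map_add, map_smul]
      module
    rw [h2, norm_sub_sq_real, norm_add_sq_real, h.eq, norm_smul, norm_smul, mul_pow, mul_pow,
      Real.norm_eq_abs, sq_abs, inner_smul_left, inner_smul_right,
      real_inner_comm (b - A x) (A z + t • b)] at h1
    simp only [conj_trivial] at h1
    nlinarith
  linarith [eq_zero_of_forall_nonneg key]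

theorem IsBottomPair.inner_residual_apply (h : IsBottomPair A b μ x) (z : E) :
    ⟪b - A x, A z⟫ = -(μ * ⟪x, z⟫) := by
  simpa using h.inner_residual z 0

theorem IsBottomPair.unique (h : IsBottomPair A b μ x)
    (hgap : ∀ z : E, z ≠ 0 → μ * ‖z‖ ^ 2 < ‖A z‖ ^ 2) {y : E}
    (hy : ‖b - A y‖ ^ 2 = μ * (1 + ‖y‖ ^ 2)) : y = x := by
  by_contra hne
  have h1 := hgap (y - x) (sub_ne_zero.2 hne)
  have h2 : b - A y = (b - A x) - A (y - x) := by
    rw [map_sub]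
    abel
  have h3 : y = x + (y - x) := by abel
  have h4 : ‖y‖ ^ 2 = ‖x‖ ^ 2 + 2 * ⟪x, y - x⟫ + ‖y - x‖ ^ 2 := by
    conv_lhs => rw [h3]
    exact norm_add_sq_real _ _
  rw [h2, norm_sub_sq_real, h.eq, h.inner_residual_apply, h4] at hy
  nlinarith

end Level

/-! ### First-order perturbation of the bottom eigenpair -/

section Perturbation

variable {E F : Type*} [NormedAddCommGroup E] [InnerProductSpace ℝ E] [CompleteSpace E]
  [NormedAddCommGroup F] [InnerProductSpace ℝ F] [CompleteSpace F]
  {A D : E →L[ℝ] F} {b d : F} {μ ν : ℝ} {x h : E}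

theorem IsBottomPair.adjoint_residual (hx : IsBottomPair A b μ x) :
    A.adjoint (b - A x) = -(μ • x) := by
  refine ext_inner_right ℝ fun z => ?_
  rw [ContinuousLinearMap.adjoint_inner_left, hx.inner_residual_apply, inner_neg_left,
    inner_smul_left]
  simp

omit [CompleteSpace E] [CompleteSpace F] in
/-- The change of the bottom eigenvalue, obtained by testing the perturbation of
`[A, b]ᵀ [A, b]` between the old and the new eigenvectors. -/
theorem IsBottomPair.sub_mul_eq (hx : IsBottomPair A b μ x)
    (hy : IsBottomPair (A + D) (b + d) ν (x + h)) :
    (ν - μ) * (1 + ‖x‖ ^ 2 + ⟪x, h⟫) = 2 * ⟪b - A x, d - D x⟫ - ⟪b - A x, D h⟫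
      - ⟪d - D x, A h⟫ + ⟪d - D x, d - D x - D h⟫ := by
  have h1 := hx.inner_residual (x + h) (-1)
  have h2 := hy.inner_residual x (-1)
  have e1 : A (x + h) + (-1 : ℝ) • b = -((b - A x) - A h) := by
    rw [map_add]; module
  have e2 : b + d - (A + D) (x + h) = (b - A x) - A h + ((d - D x) - D h) := by
    simp only [map_add, _root_.add_apply]; abel
  have e3 : (A + D) x + (-1 : ℝ) • (b + d) = -((b - A x) + (d - D x)) := by
    simp only [_root_.add_apply]; module
  rw [e1] at h1
  rw [e2, e3] at h2
  generalize b - A x = r at *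
  generalize d - D x = w at *
  simp only [inner_add_left, inner_add_right, inner_neg_right, inner_sub_left, inner_sub_right,
    real_inner_self_eq_norm_sq] at h1 h2 ⊢
  rw [real_inner_comm x h] at h2
  linarith [real_inner_comm r w, real_inner_comm r (A h),
    real_inner_comm r (D h), real_inner_comm w (A h), real_inner_comm w (D h)]

/-- The normal equations of the perturbed problem, solved for the change `h` of the solution. -/
theorem IsBottomPair.normal_eq_sub (hx : IsBottomPair A b μ x)
    (hy : IsBottomPair (A + D) (b + d) ν (x + h)) :
    A.adjoint (A h) - μ • h = A.adjoint (d - D x) + D.adjoint (b - A x) + (ν - μ) • x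
      + (D.adjoint (d - D x) - (A.adjoint (D h) + D.adjoint (A h) + D.adjoint (D h)
        - (ν - μ) • h)) := by
  have h1 := hx.adjoint_residual
  have h2 := hy.adjoint_residual
  simp only [map_add, map_sub, _root_.add_apply] at h1 h2 ⊢
  linear_combination (norm := module) h1 - h2

/-- The Householder reflection `w ↦ w - 2 ⟪r, w⟫ / ‖r‖² r` of the residual `r = b - A x` turns the
two first-order contributions of `w = d - D x` into a single application of `Aᵀ`. -/
theorem IsBottomPair.exists_reflection (hx : IsBottomPair A b μ x) (w : F) :
    ∃ w' : F, ‖w'‖ = ‖w‖ ∧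
      A.adjoint w + (2 * ⟪b - A x, w⟫ / (1 + ‖x‖ ^ 2)) • x = A.adjoint w' := by
  rcases eq_or_ne (b - A x) 0 with hr | hr
  · exact ⟨w, rfl, by simp [hr]⟩
  have hr' : ‖b - A x‖ ^ 2 ≠ 0 := by simpa using hr
  have hs : 1 + ‖x‖ ^ 2 ≠ 0 := by positivity
  refine ⟨w - (2 * ⟪b - A x, w⟫ / ‖b - A x‖ ^ 2) • (b - A x), ?_, ?_⟩
  · rw [← sq_eq_sq₀ (norm_nonneg _) (norm_nonneg _), norm_sub_sq_real, inner_smul_right,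
      real_inner_comm, norm_smul, mul_pow, Real.norm_eq_abs, sq_abs]
    field_simp
    ring
  · rw [map_sub, map_smul, hx.adjoint_residual, smul_neg, sub_neg_eq_add, smul_smul]
    -- with `‖r‖² = μ (1 + ‖x‖²)`, the coefficient of `x` is the required one after cancelling `μ`
    have hμ : μ ≠ 0 := by
      rintro rfl
      exact hr' (by simpa using hx.eq)
    congr 2
    rw [hx.eq]
    field_simp

end Perturbation

section PerturbationBound

variable {E F : Type*} [NormedAddCommGroup E] [InnerProductSpace ℝ E] [CompleteSpace E]
  [NormedAddCommGroup F] [InnerProductSpace ℝ F] [CompleteSpace F]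
  {A : E →L[ℝ] F} {b : F} {μ : ℝ} {x : E}

/-- A bound for the second-order terms of the perturbed normal equations. -/
theorem norm_secondOrder_le {D : E →L[ℝ] F} {w : F} {h : E} {κ s L ε : ℝ} (hε : 0 ≤ ε)
    (hε1 : ε ≤ 1) (hD : ‖D‖ ≤ ε) (hw : ‖w‖ ≤ s * ε) (hκ : |κ| ≤ L * ε) :
    ‖D.adjoint w - (A.adjoint (D h) + D.adjoint (A h) + D.adjoint (D h) - κ • h)‖ ≤
      s * ε ^ 2 + (2 * ‖A‖ + 1 + L) * ε * ‖h‖ := by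
  have hDh : ‖D h‖ ≤ ε * ‖h‖ := D.le_of_opNorm_le hD h
  have hDa : ∀ y, ‖D.adjoint y‖ ≤ ε * ‖y‖ := fun y =>
    D.adjoint.le_of_opNorm_le (by simpa using hD) y
  have hAa : ‖A.adjoint (D h)‖ ≤ ‖A‖ * ‖D h‖ :=
    A.adjoint.le_of_opNorm_le (by simp) (D h)
  have hAh := A.le_opNorm h
  have h1 : ‖D.adjoint w‖ ≤ ε * (s * ε) := (hDa w).trans (by gcongr)
  have h2 : ‖A.adjoint (D h)‖ ≤ ‖A‖ * (ε * ‖h‖) := hAa.trans (by gcongr)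
  have h3 : ‖D.adjoint (A h)‖ ≤ ε * (‖A‖ * ‖h‖) := (hDa _).trans (by gcongr)
  have h4 : ‖D.adjoint (D h)‖ ≤ 1 * (ε * ‖h‖) := (hDa _).trans (by gcongr)
  have h5 : ‖κ • h‖ ≤ L * ε * ‖h‖ := by
    rw [norm_smul, Real.norm_eq_abs]
    gcongr
  have h6 := norm_sub_le (D.adjoint w)
    (A.adjoint (D h) + D.adjoint (A h) + D.adjoint (D h) - κ • h)
  have h7 := norm_sub_le (A.adjoint (D h) + D.adjoint (A h) + D.adjoint (D h)) (κ • h)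
  have h8 := norm_add₃_le (a := A.adjoint (D h)) (b := D.adjoint (A h)) (c := D.adjoint (D h))
  nlinarith

/-- A first bound `‖h‖ = O(ε)`: the terms of the normal equations that contain `h` are absorbed on
the left. -/
theorem IsBottomPair.norm_le_mul (hx : IsBottomPair A b μ x) (G : E →L[ℝ] E)
    (hG : ∀ z, G (A.adjoint (A z) - μ • z) = z) {D : E →L[ℝ] F} {d : F} {ν : ℝ} {h : E}
    (hy : IsBottomPair (A + D) (b + d) ν (x + h)) {s L ε : ℝ} (hs : 0 ≤ s) (hε : 0 ≤ ε)
    (hε1 : ε ≤ 1) (hD : ‖D‖ ≤ ε) (hw : ‖d - D x‖ ≤ s * ε) (hκ : |ν - μ| ≤ L * ε)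
    (habs : ‖G‖ * (2 * ‖A‖ + 1 + L) * ε ≤ 1 / 2) :
    ‖h‖ ≤ 2 * ‖G‖ * (‖A‖ * s + ‖b - A x‖ + L * ‖x‖ + s) * ε := by
  have hnormal := hx.normal_eq_sub hy
  have hv := norm_secondOrder_le (A := A) (h := h) hε hε1 hD hw hκ
  have h1 : ‖A.adjoint (d - D x)‖ ≤ ‖A‖ * (s * ε) :=
    (A.adjoint.le_of_opNorm_le (c := ‖A‖) (by simp) _).trans (by gcongr)
  have h2 : ‖(ν - μ) • x‖ ≤ L * ε * ‖x‖ := by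
    rw [norm_smul, Real.norm_eq_abs]
    gcongr
  have h3 : ‖D.adjoint (b - A x)‖ ≤ ε * ‖b - A x‖ :=
    D.adjoint.le_of_opNorm_le (by simpa using hD) _
  have h4 : ‖A.adjoint (A h) - μ • h‖ ≤ ‖A‖ * (s * ε) + ε * ‖b - A x‖ + L * ε * ‖x‖ +
      (s * ε + (2 * ‖A‖ + 1 + L) * ε * ‖h‖) := by
    rw [hnormal]
    have h5 : s * ε ^ 2 ≤ s * ε := mul_le_mul_of_nonneg_left (by nlinarith) hs
    refine (norm_add_le _ _).trans (add_le_add (norm_add₃_le.trans ?_) (hv.trans ?_)) <;> gcongr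
  have h8 : ‖h‖ ≤ ‖G‖ * ‖A.adjoint (A h) - μ • h‖ := by
    conv_lhs => rw [← hG h]
    exact G.le_opNorm _
  have h9 := h8.trans (mul_le_mul_of_nonneg_left h4 (norm_nonneg G))
  have h10 := mul_le_mul_of_nonneg_right habs (norm_nonneg h)
  clear * - h9 h10
  generalize ‖G‖ = g, ‖b - A x‖ = ρ, ‖x‖ = X, ‖A‖ = a, ‖h‖ = k at *
  linarith

omit [CompleteSpace E] [CompleteSpace F] in
/-- The change of the bottom eigenvalue to second order. -/
theorem IsBottomPair.abs_sub_firstOrder_le (hx : IsBottomPair A b μ x) {D : E →L[ℝ] F} {d : F}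
    {ν : ℝ} {h : E} (hy : IsBottomPair (A + D) (b + d) ν (x + h)) {s L H ε : ℝ} (hs : 0 ≤ s)
    (hL : 0 ≤ L) (hH : 0 ≤ H) (hε : 0 ≤ ε) (hε1 : ε ≤ 1) (hD : ‖D‖ ≤ ε)
    (hw : ‖d - D x‖ ≤ s * ε) (hκ : |ν - μ| ≤ L * ε) (hh : ‖h‖ ≤ H * ε) :
    |ν - μ - 2 * ⟪b - A x, d - D x⟫ / (1 + ‖x‖ ^ 2)| ≤
      (L * ‖x‖ * H + ‖b - A x‖ * H + s * ‖A‖ * H + s * (s + H)) * ε ^ 2 := by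
  have hτ := hx.sub_mul_eq hy
  generalize b - A x = r at *
  generalize d - D x = w at *
  generalize ν - μ = κ at *
  set τ := κ - 2 * ⟪r, w⟫ / (1 + ‖x‖ ^ 2) with hτdef
  have hs2 : 1 ≤ 1 + ‖x‖ ^ 2 := by nlinarith
  have h1 : τ * (1 + ‖x‖ ^ 2) = -(κ * ⟪x, h⟫) - ⟪r, D h⟫ - ⟪w, A h⟫ + ⟪w, w - D h⟫ := by
    have : 2 * ⟪r, w⟫ / (1 + ‖x‖ ^ 2) * (1 + ‖x‖ ^ 2) = 2 * ⟪r, w⟫ := by field_simp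
    rw [hτdef, sub_mul, this]
    linarith
  have h2 : |κ * ⟪x, h⟫| ≤ L * ε * (‖x‖ * (H * ε)) := by
    rw [abs_mul]
    refine mul_le_mul hκ ((abs_real_inner_le_norm x h).trans (by gcongr)) (abs_nonneg _)
      (by positivity)
  have hDh : ‖D h‖ ≤ ε * (H * ε) := (D.le_of_opNorm_le hD h).trans (by gcongr)
  have h3 : |⟪r, D h⟫| ≤ ‖r‖ * (ε * (H * ε)) :=
    (abs_real_inner_le_norm _ _).trans (by gcongr)
  have h4 : |⟪w, A h⟫| ≤ s * ε * (‖A‖ * (H * ε)) :=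
    (abs_real_inner_le_norm _ _).trans (mul_le_mul hw ((A.le_opNorm h).trans (by gcongr))
      (norm_nonneg _) (by positivity))
  have h5 : |⟪w, w - D h⟫| ≤ s * ε * (s * ε + 1 * (H * ε)) :=
    (abs_real_inner_le_norm _ _).trans (mul_le_mul hw ((norm_sub_le _ _).trans
      (add_le_add hw (hDh.trans (by gcongr)))) (norm_nonneg _) (by positivity))
  have h6 : |τ| ≤ |τ * (1 + ‖x‖ ^ 2)| := by
    rw [abs_mul, abs_of_nonneg (zero_le_one.trans hs2)]
    exact le_mul_of_one_le_right (abs_nonneg _) hs2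
  refine h6.trans ?_
  rw [h1]
  rw [abs_le] at h2 h3 h4 h5 ⊢
  constructor <;> linarith

/-- The first-order bound for the change `h` of the solution, with a remainder that is uniformly
quadratic in the size `ε` of the perturbation. Here `G` plays the role of `(AᵀA - μ)⁻¹`. -/
theorem IsBottomPair.exists_perturbation_bound (hx : IsBottomPair A b μ x) (G : E →L[ℝ] E)
    (hG : ∀ z, G (A.adjoint (A z) - μ • z) = z) {L : ℝ} (hL : 0 ≤ L) :
    ∃ C η : ℝ, 0 < η ∧ η ≤ 1 ∧ ∀ (D : E →L[ℝ] F) (d : F) (ν : ℝ) (h : E) (δ ε : ℝ),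
      0 ≤ δ → δ ≤ ε → ε ≤ η → ‖D‖ ≤ δ → ‖d - D x‖ ≤ √(1 + ‖x‖ ^ 2) * δ →
      |ν - μ| ≤ L * ε → IsBottomPair (A + D) (b + d) ν (x + h) →
      ‖h‖ ≤ (‖G ∘L A.adjoint‖ * √(1 + ‖x‖ ^ 2) + ‖G‖ * ‖b - A x‖) * δ + C * ε ^ 2 := by
  set s := √(1 + ‖x‖ ^ 2)
  set r := b - A x with hr
  have hs0 : 0 ≤ s := Real.sqrt_nonneg _
  set K := 2 * ‖A‖ + 1 + L
  have hK0 : 0 ≤ K := by positivity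
  set H := 2 * ‖G‖ * (‖A‖ * s + ‖r‖ + L * ‖x‖ + s) with hH
  have hH0 : 0 ≤ H := by positivity
  set T := L * ‖x‖ * H + ‖r‖ * H + s * ‖A‖ * H + s * (s + H)
  -- `η` is small enough for `‖h‖` to be absorbed on the left when `h` is bounded crudely
  refine ⟨‖G‖ * (T * ‖x‖ + s + K * H), min 1 (1 / (2 * (‖G‖ * K + 1))), by positivity,
    min_le_left _ _, ?_⟩
  intro D d ν h δ ε hδ hδε hεη hD hw hκ hy
  have hε0 : 0 ≤ ε := hδ.trans hδε
  have hε1 : ε ≤ 1 := hεη.trans (min_le_left _ _)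
  have habs : ‖G‖ * K * ε ≤ 1 / 2 := by
    have h1 : ε ≤ 1 / (2 * (‖G‖ * K + 1)) := hεη.trans (min_le_right _ _)
    rw [le_div_iff₀ (by positivity)] at h1
    nlinarith
  have hnormal := hx.normal_eq_sub hy
  obtain ⟨w', hw', href⟩ := hx.exists_reflection (d - D x)
  rw [← hr] at hnormal href
  set w := d - D x
  set κ := ν - μ
  set v := D.adjoint w - (A.adjoint (D h) + D.adjoint (A h) + D.adjoint (D h) - κ • h)
  have hDε : ‖D‖ ≤ ε := hD.trans hδε
  have hwε : ‖w‖ ≤ s * ε := hw.trans (by gcongr)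
  have hvle : ‖v‖ ≤ s * ε ^ 2 + K * ε * ‖h‖ := norm_secondOrder_le hε0 hε1 hDε hwε hκ
  have hDr : ‖D.adjoint r‖ ≤ δ * ‖r‖ := D.adjoint.le_of_opNorm_le (by simpa using hD) r
  have hcrude : ‖h‖ ≤ H * ε := by
    rw [hH, hr]
    exact hx.norm_le_mul G hG hy hs0 hε0 hε1 hDε hwε hκ habs
  set τ := κ - 2 * ⟪r, w⟫ / (1 + ‖x‖ ^ 2) with hτdef
  have hτle : |τ| ≤ T * ε ^ 2 :=
    hx.abs_sub_firstOrder_le hy hs0 hL hH0 hε0 hε1 hDε hwε hκ hcrude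
  -- the reflection absorbs the first-order part of `κ • x`, and only `τ • x` is left
  have hsplit : h = (G ∘L A.adjoint) w' + G (D.adjoint r) + G (τ • x + v) := by
    have h1 : A.adjoint (A h) - μ • h = A.adjoint w' + D.adjoint r + (τ • x + v) := by
      rw [hnormal, ← href, hτdef]
      module
    conv_lhs => rw [← hG h, h1, map_add, map_add]
    rfl
  have h1 : ‖(G ∘L A.adjoint) w'‖ ≤ ‖G ∘L A.adjoint‖ * (s * δ) := by
    refine (ContinuousLinearMap.le_opNorm _ _).trans ?_
    rw [hw']
    gcongr
  have h2 : ‖G (D.adjoint r)‖ ≤ ‖G‖ * (δ * ‖r‖) := (G.le_opNorm _).trans (by gcongr)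
  have h3 : ‖G (τ • x + v)‖ ≤ ‖G‖ * (T * ε ^ 2 * ‖x‖ + (s * ε ^ 2 + K * ε * (H * ε))) := by
    refine (G.le_opNorm _).trans ?_
    gcongr
    refine (norm_add_le _ _).trans (add_le_add ?_ (hvle.trans (by gcongr)))
    rw [norm_smul, Real.norm_eq_abs]
    gcongr
  have h4 := norm_add₃_le (a := (G ∘L A.adjoint) w') (b := G (D.adjoint r)) (c := G (τ • x + v))
  rw [← hsplit] at h4
  linarith

end PerturbationBound

/-! ### Total least squares solutions as bottom eigenpairs -/

section Solutions

variable {m n : ℕ}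

/-- The continuous linear map between Euclidean spaces given by a matrix; `specNorm` is its
operator norm. -/
noncomputable abbrev euclideanCLM {ι κ : Type*} [Fintype ι] [Fintype κ] [DecidableEq κ]
    (M : Matrix ι κ ℝ) : EuclideanSpace ℝ κ →L[ℝ] EuclideanSpace ℝ ι :=
  (toEuclideanLin M).toContinuousLinearMap

theorem euclideanCLM_transpose {ι κ : Type*} [Fintype ι] [Fintype κ] [DecidableEq ι]
    [DecidableEq κ] (M : Matrix ι κ ℝ) :
    euclideanCLM M.transpose = (euclideanCLM M).adjoint := by
  refine (ContinuousLinearMap.eq_adjoint_iff _ _).2 fun v w => ?_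
  have h := toEuclideanLin_conjTranspose_eq_adjoint M
  rw [conjTranspose_eq_transpose_of_trivial] at h
  change ⟪toEuclideanLin M.transpose v, w⟫ = ⟪v, toEuclideanLin M w⟫
  rw [h, LinearMap.adjoint_inner_left]

theorem euclideanCLM_mul {ι κ o : Type*} [Fintype ι] [Fintype κ] [Fintype o] [DecidableEq κ]
    [DecidableEq o] (M : Matrix ι κ ℝ) (N : Matrix κ o ℝ) :
    euclideanCLM (M * N) = euclideanCLM M ∘L euclideanCLM N := by
  ext1 v
  change toEuclideanLin (M * N) v = toEuclideanLin M (toEuclideanLin N v)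
  rw [toEuclideanLin, toLpLin_mul (q := 2), LinearMap.comp_apply]

/-- The residual of `x` bounds from below every correction that makes `x` a solution. -/
theorem norm_residual_sq_le {A E : Matrix (Fin m) (Fin n) ℝ} {b f : EuclideanSpace ℝ (Fin m)}
    {x : EuclideanSpace ℝ (Fin n)} (h : toEuclideanLin (A + E) x = b + f) :
    ‖b - euclideanCLM A x‖ ^ 2 ≤ frobNorm (augment E f) ^ 2 * (1 + ‖x‖ ^ 2) := by
  have h1 : b - euclideanCLM A x = toEuclideanLin (augment E f) (pair x (-1)) := by
    rw [toEuclideanLin_augment, LinearMap.coe_toContinuousLinearMap']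
    rw [map_add, LinearMap.add_apply] at h
    linear_combination (norm := module) -h
  have h2 := norm_toEuclideanLin_le (augment E f) (pair x (-1))
  rw [← h1, norm_pair_neg_one] at h2
  have h3 := h2.trans (mul_le_mul_of_nonneg_right (specNorm_le_frobNorm _) (Real.sqrt_nonneg _))
  have h4 := pow_le_pow_left₀ (norm_nonneg _) h3 2
  rwa [mul_pow, Real.sq_sqrt (by positivity)] at h4

/-- The lower bound `norm_residual_sq_le` is attained, by the rank-one correction
`[E, f] = r (x, -1)ᵀ / (1 + ‖x‖²)` with `r = b - A x`. -/
theorem exists_correction (A : Matrix (Fin m) (Fin n) ℝ) (b : EuclideanSpace ℝ (Fin m))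
    (x : EuclideanSpace ℝ (Fin n)) : ∃ (E : Matrix (Fin m) (Fin n) ℝ)
      (f : EuclideanSpace ℝ (Fin m)), toEuclideanLin (A + E) x = b + f ∧
      frobNorm (augment E f) ^ 2 * (1 + ‖x‖ ^ 2) = ‖b - euclideanCLM A x‖ ^ 2 := by
  set r := b - euclideanCLM A x with hr
  have hs : 1 + ‖x‖ ^ 2 ≠ 0 := by positivity
  set c := (1 + ‖x‖ ^ 2)⁻¹ with hc
  have hcs : c * (1 + ‖x‖ ^ 2) = 1 := inv_mul_cancel₀ hs
  have hE : toEuclideanLin (c • vecMulVec r.ofLp x.ofLp) x = (c * ‖x‖ ^ 2) • r := by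
    ext i
    simp only [Matrix.toLpLin_apply, Matrix.mulVec, dotProduct, Matrix.smul_apply, vecMulVec_apply,
      EuclideanSpace.norm_sq_eq, PiLp.smul_apply, smul_eq_mul, Real.norm_eq_abs, sq_abs,
      Finset.mul_sum, Finset.sum_mul]
    exact Finset.sum_congr rfl fun j _ => by ring
  refine ⟨c • vecMulVec r.ofLp x.ofLp, -(c • r), ?_, ?_⟩
  · have h1 : toEuclideanLin A x = b - r := by rw [hr]; simp
    rw [map_add, LinearMap.add_apply, hE, h1]
    have h2 : c * ‖x‖ ^ 2 = 1 - c := by linarith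
    rw [h2]
    module
  · have h1 : ∑ i, ∑ j, (c • vecMulVec r.ofLp x.ofLp) i j ^ 2 = c ^ 2 * (‖r‖ ^ 2 * ‖x‖ ^ 2) := by
      simp only [EuclideanSpace.norm_sq_eq, Real.norm_eq_abs, sq_abs, Matrix.smul_apply,
        vecMulVec_apply, smul_eq_mul, mul_pow]
      rw [Finset.sum_mul_sum, Finset.mul_sum]
      simp only [Finset.mul_sum]
    rw [frobNorm_augment_sq, h1, norm_neg, norm_smul, mul_pow, Real.norm_eq_abs, sq_abs]
    linear_combination ‖r‖ ^ 2 * (c * (1 + ‖x‖ ^ 2) + 1) * hcs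

theorem isTLSSolution_iff {A : Matrix (Fin m) (Fin n) ℝ} {b : EuclideanSpace ℝ (Fin m)} {μ : ℝ}
    {x : EuclideanSpace ℝ (Fin n)} (hx : IsBottomPair (euclideanCLM A) b μ x)
    (hgap : ∀ z, z ≠ 0 → μ * ‖z‖ ^ 2 < ‖euclideanCLM A z‖ ^ 2)
    {y : EuclideanSpace ℝ (Fin n)} : IsTLSSolution A b y ↔ y = x := by
  have hle : ∀ z, μ * (1 + ‖z‖ ^ 2) ≤ ‖b - euclideanCLM A z‖ ^ 2 := fun z => by
    have h1 := hx.le z (-1)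
    have h2 : euclideanCLM A z + (-1 : ℝ) • b = -(b - euclideanCLM A z) := by module
    rw [h2, norm_neg] at h1
    linarith
  have hsol : ∀ z : EuclideanSpace ℝ (Fin n), 0 < 1 + ‖z‖ ^ 2 := fun z => by positivity
  constructor
  · rintro ⟨E, f, h, hmin⟩
    refine hx.unique hgap (le_antisymm ?_ (hle y))
    obtain ⟨E', f', h', hE'⟩ := exists_correction A b x
    refine (norm_residual_sq_le h).trans (mul_le_mul_of_nonneg_right ?_ (hsol y).le)
    rw [hx.eq] at hE'
    rw [← mul_right_cancel₀ (hsol x).ne' hE']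
    exact pow_le_pow_left₀ (frobNorm_nonneg _) (hmin E' f' ⟨x, h'⟩) 2
  · rintro rfl
    obtain ⟨E, f, h, hE⟩ := exists_correction A b y
    rw [hx.eq] at hE
    refine ⟨E, f, h, fun E' f' hf' => ?_⟩
    obtain ⟨z, hz⟩ := hf'
    refine le_of_sq_le_sq ?_ (frobNorm_nonneg _)
    rw [mul_right_cancel₀ (hsol y).ne' hE]
    exact le_of_mul_le_mul_right ((hle z).trans (norm_residual_sq_le hz)) (hsol z)

end Solutions

/-! ### The genericity condition -/

section Generic

variable {m n : ℕ}

theorem finrank_augmented_domain :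
    Module.finrank ℝ (EuclideanSpace ℝ (Fin n ⊕ Unit)) = n + 1 := by
  simp

theorem sq_mul_lt_of_gap (hn : 1 ≤ n) {A : Matrix (Fin m) (Fin n) ℝ} {σ : ℝ} (hσ : 0 ≤ σ)
    (hgen : σ < singularValue A n) (z : EuclideanSpace ℝ (Fin n)) (hz : z ≠ 0) :
    σ ^ 2 * ‖z‖ ^ 2 < ‖euclideanCLM A z‖ ^ 2 := by
  have hz' : 0 < ‖z‖ := norm_pos_iff.2 hz
  have h1 := singularValues_mul_norm_le (toEuclideanLin A) (k := n - 1)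
    (by rw [finrank_euclideanSpace_fin]; omega) z
  have h2 : σ * ‖z‖ < ‖toEuclideanLin A z‖ := (mul_lt_mul_of_pos_right hgen hz').trans_le h1
  rw [← mul_pow]
  exact pow_lt_pow_left₀ h2 (by positivity) two_ne_zero

theorem singularValue_nonneg {ι κ : Type*} [Fintype ι] [Fintype κ] [DecidableEq κ]
    (M : Matrix ι κ ℝ) (k : ℕ) : 0 ≤ singularValue M k :=
  LinearMap.singularValues_nonneg _ _

/-- Under the genericity condition a bottom right singular vector of `[A, b]` has a nonzero last
coordinate, so that it can be scaled to `(x, -1)`. -/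
theorem exists_isBottomPair (hn : 1 ≤ n) {A : Matrix (Fin m) (Fin n) ℝ}
    {b : EuclideanSpace ℝ (Fin m)}
    (hgen : singularValue (augment A b) (n + 1) < singularValue A n) :
    ∃ x, IsBottomPair (euclideanCLM A) b (singularValue (augment A b) (n + 1) ^ 2) x := by
  set σ := singularValue (augment A b) (n + 1) with hσ
  obtain ⟨v, hv, hve⟩ := exists_norm_eq_singularValues_mul (toEuclideanLin (augment A b))
    finrank_augmented_domain
  obtain ⟨z, t, rfl⟩ := exists_pair_eq v
  have heq : ‖toEuclideanLin A z + t • b‖ ^ 2 = σ ^ 2 * (‖z‖ ^ 2 + t ^ 2) := by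
    rw [← toEuclideanLin_augment, hve, mul_pow, norm_pair_sq]
    rfl
  have ht : t ≠ 0 := by
    rintro rfl
    have hz : z ≠ 0 := by
      rintro rfl
      rw [← norm_ne_zero_iff, norm_pair_zero] at hv
      simp at hv
    have := sq_mul_lt_of_gap hn (singularValue_nonneg _ _) hgen z hz
    rw [LinearMap.coe_toContinuousLinearMap'] at this
    simp at heq
    linarith
  refine ⟨-(t⁻¹ • z), fun y u => ?_, ?_⟩
  · have h1 := singularValues_mul_norm_le (toEuclideanLin (augment A b))
      finrank_augmented_domain (pair y u)
    have h2 := pow_le_pow_left₀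
      (mul_nonneg (LinearMap.singularValues_nonneg _ _) (norm_nonneg _)) h1 2
    rw [mul_pow, norm_pair_sq, toEuclideanLin_augment] at h2
    exact h2
  · have h1 : b - euclideanCLM A (-(t⁻¹ • z)) = t⁻¹ • (toEuclideanLin A z + t • b) := by
      rw [smul_add, smul_smul, inv_mul_cancel₀ ht, map_neg, map_smul,
        LinearMap.coe_toContinuousLinearMap']
      module
    rw [h1, norm_smul, mul_pow, heq, norm_neg, norm_smul, mul_pow, Real.norm_eq_abs, sq_abs]
    field_simp
    ring

theorem singularValues_le_add {E F : Type*} [NormedAddCommGroup E] [InnerProductSpace ℝ E]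
    [FiniteDimensional ℝ E] [NormedAddCommGroup F] [InnerProductSpace ℝ F] [FiniteDimensional ℝ F]
    {S T : E →ₗ[ℝ] F} {k : ℕ} (hk : Module.finrank ℝ E = k + 1) {c : ℝ}
    (h : ∀ v, ‖S v - T v‖ ≤ c * ‖v‖) : S.singularValues k ≤ T.singularValues k + c := by
  obtain ⟨v, hv, hve⟩ := exists_norm_eq_singularValues_mul T hk
  have h1 := singularValues_mul_norm_le S hk v
  have h2 : ‖S v‖ ≤ ‖T v‖ + ‖S v - T v‖ := norm_le_insert' _ _
  refine le_of_mul_le_mul_right ?_ (norm_pos_iff.2 hv)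
  linarith [h v, add_mul (T.singularValues k) c ‖v‖]

/-- Weyl's inequality for the bottom singular value. -/
theorem abs_singularValues_sub_le {E F : Type*} [NormedAddCommGroup E] [InnerProductSpace ℝ E]
    [FiniteDimensional ℝ E] [NormedAddCommGroup F] [InnerProductSpace ℝ F] [FiniteDimensional ℝ F]
    {S T : E →ₗ[ℝ] F} {k : ℕ} (hk : Module.finrank ℝ E = k + 1) {c : ℝ}
    (h : ∀ v, ‖S v - T v‖ ≤ c * ‖v‖) : |S.singularValues k - T.singularValues k| ≤ c := by
  have h1 := singularValues_le_add hk h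
  have h2 := singularValues_le_add (S := T) (T := S) hk fun v => by
    rw [norm_sub_rev]
    exact h v
  rw [abs_le]
  constructor <;> linarith

theorem augment_add (A dA : Matrix (Fin m) (Fin n) ℝ) (b db : EuclideanSpace ℝ (Fin m)) :
    augment (A + dA) (b + db) = augment A b + augment dA db := by
  ext i (j | j) <;> simp [augment]

theorem norm_euclideanCLM_le_specNorm_augment (A : Matrix (Fin m) (Fin n) ℝ)
    (b : EuclideanSpace ℝ (Fin m)) : ‖euclideanCLM A‖ ≤ specNorm (augment A b) := by
  refine ContinuousLinearMap.opNorm_le_bound _ (specNorm_nonneg _) fun z => ?_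
  have h := norm_toEuclideanLin_le (augment A b) (pair z 0)
  rwa [toEuclideanLin_augment, zero_smul, add_zero, norm_pair_zero] at h

theorem abs_singularValue_augment_sub_le (A dA : Matrix (Fin m) (Fin n) ℝ)
    (b db : EuclideanSpace ℝ (Fin m)) :
    |singularValue (augment (A + dA) (b + db)) (n + 1) - singularValue (augment A b) (n + 1)| ≤
      specNorm (augment dA db) := by
  refine abs_singularValues_sub_le finrank_augmented_domain fun v => ?_
  rw [augment_add, map_add, LinearMap.add_apply, add_sub_cancel_left]
  exact norm_toEuclideanLin_le _ _

theorem abs_singularValue_sub_le (hn : 1 ≤ n) (A dA : Matrix (Fin m) (Fin n) ℝ)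
    (db : EuclideanSpace ℝ (Fin m)) :
    |singularValue (A + dA) n - singularValue A n| ≤ specNorm (augment dA db) := by
  refine abs_singularValues_sub_le (by rw [finrank_euclideanSpace_fin]; omega) fun v => ?_
  rw [map_add, LinearMap.add_apply, add_sub_cancel_left]
  exact (euclideanCLM dA).le_of_opNorm_le (norm_euclideanCLM_le_specNorm_augment dA db) v

theorem shiftedGramInv_apply {A : Matrix (Fin m) (Fin n) ℝ} {b : EuclideanSpace ℝ (Fin m)}
    (hgap : ∀ z, z ≠ 0 →
      singularValue (augment A b) (n + 1) ^ 2 * ‖z‖ ^ 2 < ‖euclideanCLM A z‖ ^ 2)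
    (z : EuclideanSpace ℝ (Fin n)) :
    euclideanCLM (shiftedGramInv A b) ((euclideanCLM A).adjoint (euclideanCLM A z) -
      singularValue (augment A b) (n + 1) ^ 2 • z) = z := by
  set μ := singularValue (augment A b) (n + 1) ^ 2 with hμ
  set N := A.transpose * A - μ • (1 : Matrix (Fin n) (Fin n) ℝ) with hN
  have hNz : ∀ z, toEuclideanLin N z =
      (euclideanCLM A).adjoint (euclideanCLM A z) - μ • z := fun z => by
    have h1 := congrArg (fun f => f z) (euclideanCLM_mul A.transpose A)
    rw [euclideanCLM_transpose] at h1
    have h2 : toEuclideanLin (A.transpose * A) z =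
      (euclideanCLM A).adjoint (euclideanCLM A z) := h1
    have h3 : toEuclideanLin (1 : Matrix (Fin n) (Fin n) ℝ) z = z := by
      rw [toEuclideanLin, toLpLin_one, LinearMap.id_apply]
    rw [hN, map_sub, map_smul, LinearMap.sub_apply, LinearMap.smul_apply, h2, h3]
  have hinj : Function.Injective N.mulVec := by
    refine (injective_iff_map_eq_zero N.mulVecLin).2 fun v hv => ?_
    by_contra hne
    have h1 : toEuclideanLin N (WithLp.toLp 2 v) = 0 := by
      rw [Matrix.toLpLin_apply]
      exact congrArg (WithLp.toLp 2) hv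
    have h2 := congrArg (fun y => ⟪y, WithLp.toLp 2 v⟫) ((hNz _).symm.trans h1)
    simp only [inner_sub_left, ContinuousLinearMap.adjoint_inner_left, inner_smul_left,
      real_inner_self_eq_norm_sq, inner_zero_left, conj_trivial] at h2
    have h3 := hgap (WithLp.toLp 2 v) fun h => hne (by simpa using h)
    linarith
  have hunit : IsUnit N.det :=
    (Matrix.isUnit_iff_isUnit_det N).1 (Matrix.mulVec_injective_iff_isUnit.1 hinj)
  have hinv : shiftedGramInv A b = N⁻¹ := rfl
  have h1 := congrArg (fun f => f z) (euclideanCLM_mul N⁻¹ N)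
  rw [Matrix.nonsing_inv_mul N hunit] at h1
  have h2 : toEuclideanLin (1 : Matrix (Fin n) (Fin n) ℝ) z =
    euclideanCLM N⁻¹ (toEuclideanLin N z) := h1
  rw [hinv, ← hNz, ← h2, toEuclideanLin, toLpLin_one, LinearMap.id_apply]

end Generic

end TLS

open TLS in
theorem mainTheorem2 {m n : ℕ} (hn : 1 ≤ n) (hmn : n ≤ m)
    (A : Matrix (Fin m) (Fin n) ℝ) (b : EuclideanSpace ℝ (Fin m))
    (hgen : TLS.singularValue A n > TLS.singularValue (TLS.augment A b) (n + 1)) :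
    (∃! x : EuclideanSpace ℝ (Fin n), TLS.IsTLSSolution A b x) ∧
    ∀ x : EuclideanSpace ℝ (Fin n), TLS.IsTLSSolution A b x → x ≠ 0 →
      ∃ C η : ℝ, 0 < η ∧
        ∀ (dA : Matrix (Fin m) (Fin n) ℝ) (db : EuclideanSpace ℝ (Fin m)),
          TLS.frobNorm (TLS.augment dA db) ≤ η →
          (∃! y : EuclideanSpace ℝ (Fin n), TLS.IsTLSSolution (A + dA) (b + db) y) ∧
          ∀ dx : EuclideanSpace ℝ (Fin n), TLS.IsTLSSolution (A + dA) (b + db) (x + dx) →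
            ‖dx‖ / ‖x‖ ≤
              (TLS.specNorm (TLS.shiftedGramInv A b * A.transpose) *
                  (Real.sqrt (1 + ‖x‖ ^ 2) / ‖x‖) +
                TLS.specNorm (TLS.shiftedGramInv A b) *
                  (‖b - Matrix.toEuclideanLin A x‖ / ‖x‖)) *
                TLS.specNorm (TLS.augment dA db) +
              C * TLS.frobNorm (TLS.augment dA db) ^ 2 := by
  obtain ⟨x₀, hx₀⟩ := exists_isBottomPair hn hgen
  have hgap := sq_mul_lt_of_gap hn (singularValue_nonneg _ _) hgen
  refine ⟨⟨x₀, (isTLSSolution_iff hx₀ hgap).2 rfl, fun y => (isTLSSolution_iff hx₀ hgap).1⟩, ?_⟩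
  intro x hx hne
  obtain rfl := (isTLSSolution_iff hx₀ hgap).1 hx
  set σ := singularValue (augment A b) (n + 1) with hσ
  have hσ0 : 0 ≤ σ := singularValue_nonneg _ _
  obtain ⟨C, η, hη, hη1, hbound⟩ := hx₀.exists_perturbation_bound
    (euclideanCLM (shiftedGramInv A b)) (shiftedGramInv_apply hgap)
    (L := 2 * σ + 1) (by positivity)
  -- each of the two singular values moves by at most `ε`, so a third of the gap keeps it open
  refine ⟨C / ‖x‖, min η ((singularValue A n - σ) / 3), lt_min hη (by linarith), ?_⟩
  intro dA db hsmall
  set ε := frobNorm (augment dA db)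
  set δ := specNorm (augment dA db)
  have hδ0 : 0 ≤ δ := specNorm_nonneg _
  have hδε : δ ≤ ε := specNorm_le_frobNorm _
  have hεη : ε ≤ η := hsmall.trans (min_le_left _ _)
  have hεgap : ε ≤ (singularValue A n - σ) / 3 := hsmall.trans (min_le_right _ _)
  have h1 := abs_le.1 (abs_singularValue_sub_le hn A dA db)
  have h2 := abs_le.1 (abs_singularValue_augment_sub_le A dA b db)
  have hgen' : singularValue (augment (A + dA) (b + db)) (n + 1) < singularValue (A + dA) n := by
    linarith
  obtain ⟨y, hy⟩ := exists_isBottomPair hn hgen'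
  have hgap' := sq_mul_lt_of_gap hn (singularValue_nonneg _ _) hgen'
  refine ⟨⟨y, (isTLSSolution_iff hy hgap').2 rfl, fun z => (isTLSSolution_iff hy hgap').1⟩, ?_⟩
  intro dx hdx
  obtain rfl := (isTLSSolution_iff hy hgap').1 hdx
  have hσ' := singularValue_nonneg (augment (A + dA) (b + db)) (n + 1)
  have hw : ‖db - euclideanCLM dA x‖ ≤ √(1 + ‖x‖ ^ 2) * δ := by
    have h3 := norm_toEuclideanLin_le (augment dA db) (pair x (-1))
    rw [toEuclideanLin_augment, norm_pair_neg_one, mul_comm] at h3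
    have h4 : db - euclideanCLM dA x = -(Matrix.toEuclideanLin dA x + (-1 : ℝ) • db) := by
      rw [LinearMap.coe_toContinuousLinearMap']
      module
    rwa [h4, norm_neg]
  have hν : |singularValue (augment (A + dA) (b + db)) (n + 1) ^ 2 - σ ^ 2| ≤
      (2 * σ + 1) * ε := by
    rw [sq_sub_sq, abs_mul, abs_of_nonneg (by positivity)]
    exact mul_le_mul (by linarith) ((abs_le.2 h2).trans hδε) (abs_nonneg _) (by positivity)
  have hsum : euclideanCLM (A + dA) = euclideanCLM A + euclideanCLM dA := by
    simp [euclideanCLM]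
  rw [hsum] at hy
  have h3 := hbound (euclideanCLM dA) db _ dx δ ε hδ0 hδε hεη
    (norm_euclideanCLM_le_specNorm_augment dA db) hw hν hy
  rw [← euclideanCLM_transpose, ← euclideanCLM_mul] at h3
  have hx' : 0 < ‖x‖ := norm_pos_iff.2 hne
  rw [div_le_iff₀ hx']
  refine h3.trans (le_of_eq ?_)
  change (specNorm (shiftedGramInv A b * A.transpose) * _ + specNorm (shiftedGramInv A b) *
    ‖b - Matrix.toEuclideanLin A x‖) * δ + _ = _
  field_simp
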